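/- **Channel coding theorem.** Let $\mathcal X$ and $\mathcal Y$ be finite alphabets, $\mathcal X\neq\emptyset$, and let $T_{Y|X}$ be a stochastic transition matrix: $T(y|x)\ge 0$ and $\sum_{y}T(y|x)=1$ for every $x$. For a probability distribution $p$ on $\mathcal X$ put $P(x,y)=p(x)T(y|x)$, $q(y)=\sum_x P(x,y)$ and $$I(X;Y)=\sum_{x,y}P(x,y)\log_2\frac{P(x,y)}{p(x)\,q(y)}\qquad(0\log 0=0).$$ The channel is used without memory and without feedback: $T^m(y^m|x^m)=\prod_{i=1}^m T(y_i|x_i)$. A code with $M$ messages and block length $m$ consists of an encoder $g:\{1,\dots,M\}\to\mathcal X^m$ and a decoder $h:\mathcal Y^m\to\{1,\dots,M\}$; its probability of error, for equiprobable messages, is $$P_e=\frac1M\sum_{w=1}^M\ \sum_{y^m:\,h(y^m)\ne w}T^m(y^m|g(w)).$$ A real number $R$ is called an achievable rate if there is a sequence of codes, one with $M_m$ messages for each block length $m$, with $P_e\to 0$ as $m\to\infty$ and $\liminf_{m\to\infty}\frac1m\log_2 M_m\ge R$. Then: 1. The maximum $C=\max_{p}I(X;Y)$ over all probability distributions $p$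 on $\mathcal X$ exists. 2. $R$ is achievable if and only if $R\le C$. 3. For every $R<C$ there are codes with exactly $\lceil 2^{mR}\rceil$ messages, one for each block length $m$, with $P_e\to0$ as $m\to\infty$. 4. Conversely, if for some real $R$ there are codes with exactly $\lfloor 2^{mR}\rfloor$ messages, one for each block length $m$, with $P_e\to0$ as $m\to\infty$, then $R\le C$. -/

import Mathlib

open Filter Topology

/-- A discrete channel with input alphabet `X` and output alphabet `Y`: a stochastic transition
matrix, with `T.matrix y x` the probability of the output `y` given the input `x`. The columns sum
to one, so that an input distribution `p` is mapped to the output distribution `T.matrix *ᵥ p`. -/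
structure Channel (X Y : Type*) [Fintype Y] where
  matrix : Matrix Y X ℝ
  nonneg : ∀ y x, 0 ≤ matrix y x
  sum_col : ∀ x, ∑ y, matrix y x = 1

/-- Mutual information, in bits, of a joint distribution `P` on `X × Y`:
`∑ P(x,y) log₂ (P(x,y) / (p(x) q(y)))` with `p`, `q` the marginals of `P`. -/
noncomputable def mutualInfo {X Y : Type*} [Fintype X] [Fintype Y] (P : X → Y → ℝ) : ℝ :=
  ∑ x, ∑ y, P x y * Real.logb 2 (P x y / ((∑ y', P x y') * (∑ x', P x' y)))

/-- A block code with `M` messages and block length `m`: a deterministic encoder and a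
deterministic decoder. -/
structure BlockCode (X Y : Type*) (M m : ℕ) where
  encode : Fin M → (Fin m → X)
  decode : (Fin m → Y) → Fin M

namespace Channel

variable {X Y : Type*} [Fintype Y]

/-- The joint distribution of input and output when the input has distribution `p`. -/
def joint (T : Channel X Y) (p : X → ℝ) : X → Y → ℝ :=
  fun x y => p x * T.matrix y x

/-- The mutual information `I(X;Y)` between input and output when the input has
distribution `p`. -/
noncomputable def inputOutputInfo [Fintype X] (T : Channel X Y) (p : X → ℝ) : ℝ :=
  mutualInfo (T.joint p)

/-- The capacity: the supremum of `I(X;Y)` over all input distributions. -/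
noncomputable def capacity [Fintype X] (T : Channel X Y) : ℝ :=
  sSup (T.inputOutputInfo '' stdSimplex ℝ X)

/-- `m` uses of the channel, without memory and without feedback. -/
def memoryless (T : Channel X Y) (m : ℕ) : Channel (Fin m → X) (Fin m → Y) where
  matrix := fun ys xs => ∏ i, T.matrix (ys i) (xs i)
  nonneg := fun ys xs => Finset.prod_nonneg fun i _ => T.nonneg (ys i) (xs i)
  sum_col := fun xs => by
    classical
    rw [← Fintype.prod_sum (fun i y => T.matrix y (xs i))]
    exact Finset.prod_eq_one fun i _ => T.sum_col (xs i)

/-- The probability that the decoder does not output `w` when the message `w` is sent. -/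
def messageError (T : Channel X Y) {M m : ℕ} (c : BlockCode X Y M m) (w : Fin M) : ℝ :=
  ∑ ys : Fin m → Y with c.decode ys ≠ w, (T.memoryless m).matrix ys (c.encode w)

/-- The probability of error of a code when the messages are equiprobable. -/
noncomputable def errorProb (T : Channel X Y) {M m : ℕ} (c : BlockCode X Y M m) : ℝ :=
  (∑ w, T.messageError c w) / M

/-- Reliable transmission with `M m` messages at block length `m`: there are codes of these sizes
whose probability of error vanishes as `m → ∞`. -/
def IsReliable (T : Channel X Y) (M : ℕ → ℕ) : Prop :=
  ∃ c : ∀ m, BlockCode X Y (M m) m, Tendsto (fun m => T.errorProb (c m)) atTop (𝓝 0)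

/-- The rate `R`, in bits per channel use, is achievable: there is a sequence of codes with
vanishing probability of error whose rates `log₂ (M m) / m` are asymptotically at least `R`. -/
def IsAchievable (T : Channel X Y) (R : ℝ) : Prop :=
  ∃ M : ℕ → ℕ, (∀ δ > 0, ∀ᶠ m : ℕ in atTop, R - δ ≤ Real.logb 2 (M m) / m) ∧ T.IsReliable M

end Channel

/-! The mutual information is continuous on the compact simplex, so a maximizing input `p` exists.

Direct part: Feinstein's greedy construction (`exists_code_error_le`) gives, for any channel, codes
whose error is at most the probability that the likelihood ratio W/q is at most γ, plus (M - 1)/γ.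
For the memoryless channel with i.i.d. input from the maximizing `p`, log(W/q) is a sum of i.i.d.
terms of mean J = C log 2. With γ = exp(m(J - δ)), a Chernoff bound makes the first term small.
Letting δ shrink like m^(-1/4) reaches R = C itself, not only rates below it.

Converse: compare the channel output for each message with the product Q of the single-letter output
distributions. The divergences from Q split over letters, so their average over messages is at most
m C log 2. Testing them against log M times the indicator of correct decoding bounds this average
below by (1 - P_e) log M - 1. -/

lemma sum_biUnion_le_of_nonneg {ι α : Type*} [DecidableEq ι] [DecidableEq α] (s : Finset ι)
    (t : ι → Finset α) {f : α → ℝ} (hf : ∀ a, 0 ≤ f a) :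
    ∑ a ∈ s.biUnion t, f a ≤ ∑ i ∈ s, ∑ a ∈ t i, f a := by
  induction s using Finset.induction_on with
  | empty => simp
  | insert i s hi ih =>
    rw [Finset.biUnion_insert, Finset.sum_insert hi]
    refine le_trans ?_ (add_le_add_right ih _)
    rw [← Finset.sum_union_inter]
    exact le_add_of_nonneg_right (Finset.sum_nonneg fun a _ => hf a)

namespace Channel

/-! ### Mutual information as an average divergence; existence of the maximum -/

section General

variable {X Y : Type*} [Fintype Y]

/-- The output distribution of the channel for the input distribution `p`. -/
def output [Fintype X] (T : Channel X Y) (p : X → ℝ) (y : Y) : ℝ :=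
  ∑ x, p x * T.matrix y x

/-- The divergence, in nats, of the output distribution for the input `x` from `q`. -/
noncomputable def divergence (T : Channel X Y) (q : Y → ℝ) (x : X) : ℝ :=
  ∑ y, T.matrix y x * Real.log (T.matrix y x / q y)

variable [Fintype X] (T : Channel X Y)

lemma output_nonneg {p : X → ℝ} (hp : ∀ x, 0 ≤ p x) (y : Y) : 0 ≤ T.output p y :=
  Finset.sum_nonneg fun x _ => mul_nonneg (hp x) (T.nonneg y x)

lemma output_pos {p : X → ℝ} (hp : ∀ x, 0 ≤ p x) {x : X} {y : Y} (hx : 0 < p x)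
    (hT : 0 < T.matrix y x) : 0 < T.output p y :=
  (mul_pos hx hT).trans_le
    (Finset.single_le_sum (f := fun x => p x * T.matrix y x)
      (fun x _ => mul_nonneg (hp x) (T.nonneg y x)) (Finset.mem_univ x))

lemma sum_output {p : X → ℝ} (hp : ∑ x, p x = 1) : ∑ y, T.output p y = 1 := by
  unfold output
  rw [Finset.sum_comm]
  simp_rw [← Finset.mul_sum, T.sum_col, mul_one, hp]

lemma inputOutputInfo_mul_log_two (p : X → ℝ) :
    T.inputOutputInfo p * Real.log 2 = ∑ x, p x * T.divergence (T.output p) x := by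
  have h2 : Real.log 2 ≠ 0 := (Real.log_pos one_lt_two).ne'
  unfold inputOutputInfo mutualInfo divergence
  rw [Finset.sum_mul]
  refine Finset.sum_congr rfl fun x _ => ?_
  rw [Finset.sum_mul, Finset.mul_sum]
  refine Finset.sum_congr rfl fun y _ => ?_
  have h1 : ∑ y', T.joint p x y' = p x := by
    simp only [joint, ← Finset.mul_sum, T.sum_col, mul_one]
  rw [h1]
  change p x * T.matrix y x * Real.logb 2 (p x * T.matrix y x / (p x * T.output p y)) *
    Real.log 2 = _
  rcases eq_or_ne (p x) 0 with h | h
  · simp [h]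
  · rw [mul_div_mul_left _ _ h, Real.logb]
    field_simp

/-- Splitting the logarithm leaves a term linear in `p` and the output entropy, both visibly
continuous even where probabilities vanish. -/
lemma sum_mul_divergence_output {p : X → ℝ} (hp : ∀ x, 0 ≤ p x) :
    ∑ x, p x * T.divergence (T.output p) x =
      ∑ x, p x * ∑ y, T.matrix y x * Real.log (T.matrix y x) +
        ∑ y, Real.negMulLog (T.output p y) := by
  have h : ∑ y, Real.negMulLog (T.output p y) =
      ∑ x, p x * ∑ y, -(T.matrix y x * Real.log (T.output p y)) := by
    simp_rw [Finset.mul_sum]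
    rw [Finset.sum_comm]
    refine Finset.sum_congr rfl fun y _ => ?_
    rw [Real.negMulLog]
    conv_lhs => rw [output]
    rw [← Finset.sum_neg_distrib, Finset.sum_mul]
    exact Finset.sum_congr rfl fun x _ => by rw [output]; ring
  rw [h, ← Finset.sum_add_distrib]
  refine Finset.sum_congr rfl fun x _ => ?_
  rw [← mul_add, ← Finset.sum_add_distrib]
  rcases (hp x).eq_or_lt with h0 | h0
  · simp [← h0]
  refine congrArg _ (Finset.sum_congr rfl fun y _ => ?_)
  rcases (T.nonneg y x).eq_or_lt with h1 | h1
  · simp [← h1]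
  · rw [Real.log_div h1.ne' (T.output_pos hp h0 h1).ne']
    ring

lemma continuousOn_inputOutputInfo : ContinuousOn T.inputOutputInfo (stdSimplex ℝ X) := by
  have h2 : Real.log 2 ≠ 0 := (Real.log_pos one_lt_two).ne'
  have hc : Continuous fun p : X → ℝ =>
      (∑ x, p x * ∑ y, T.matrix y x * Real.log (T.matrix y x) +
        ∑ y, Real.negMulLog (T.output p y)) / Real.log 2 := by
    unfold output
    have := Real.continuous_negMulLog
    fun_prop
  refine hc.continuousOn.congr fun p hp => ?_
  rw [eq_div_iff h2, inputOutputInfo_mul_log_two, sum_mul_divergence_output T hp.1]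

lemma isGreatest_capacity [Nonempty X] :
    IsGreatest (T.inputOutputInfo '' stdSimplex ℝ X) T.capacity := by
  classical
  have hne : (stdSimplex ℝ X).Nonempty :=
    ⟨_, single_mem_stdSimplex ℝ (Classical.arbitrary X)⟩
  exact ((isCompact_stdSimplex ℝ X).image_of_continuousOn
    T.continuousOn_inputOutputInfo).isGreatest_sSup (hne.image _)

lemma sum_mul_divergence_le_capacity [Nonempty X] {p : X → ℝ} (hp : p ∈ stdSimplex ℝ X) :
    ∑ x, p x * T.divergence (T.output p) x ≤ T.capacity * Real.log 2 := by
  rw [← inputOutputInfo_mul_log_two]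
  exact mul_le_mul_of_nonneg_right (T.isGreatest_capacity.2 ⟨p, hp, rfl⟩)
    (Real.log_pos one_lt_two).le

end General

/-! ### Feinstein's construction for a single use of an arbitrary channel -/

section OneShot

variable {A B : Type*} [Fintype B] (W : Channel A B)

open Classical in
/-- The outputs that are more than `γ` times likelier for the input `a` than under `q`. -/
noncomputable def likelyOutputs (q : B → ℝ) (γ : ℝ) (a : A) : Finset B :=
  {b | γ * q b < W.matrix b a}

open Classical in
/-- The outputs that are at most `γ` times likelier for the input `a` than under `q`. -/
noncomputable def unlikelyOutputs (q : B → ℝ) (γ : ℝ) (a : A) : Finset B :=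
  {b | W.matrix b a ≤ γ * q b}

lemma mem_unlikelyOutputs {q : B → ℝ} {γ : ℝ} {a : A} {b : B} :
    b ∈ W.unlikelyOutputs q γ a ↔ W.matrix b a ≤ γ * q b := by
  classical
  simp [unlikelyOutputs]

lemma mem_likelyOutputs {q : B → ℝ} {γ : ℝ} {a : A} {b : B} :
    b ∈ W.likelyOutputs q γ a ↔ γ * q b < W.matrix b a := by
  classical
  simp [likelyOutputs]

variable [Fintype A]

/-- On this set γ q < W(·|a), and W(·|a) has total mass one. -/
lemma sum_output_likelyOutputs_le {p : A → ℝ} {γ : ℝ} (hγ : 0 < γ) (a : A) :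
    ∑ b ∈ W.likelyOutputs (W.output p) γ a, W.output p b ≤ γ⁻¹ := by
  rw [← one_div, le_div_iff₀' hγ, Finset.mul_sum, ← W.sum_col a]
  refine (Finset.sum_le_sum fun b hb => ?_).trans
    (Finset.sum_le_univ_sum_of_nonneg fun b => W.nonneg b a)
  exact (W.mem_likelyOutputs.1 hb).le

/-- Given finitely many codewords, a further one can be chosen whose output is, on average, likely
for it and for none of the previous ones. -/
lemma exists_next_codeword {p : A → ℝ} (hp : p ∈ stdSimplex ℝ A) {γ : ℝ} (hγ : 0 < γ)
    (n : ℕ) (c : ℕ → A) :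
    ∃ a, ∑ b ∈ W.unlikelyOutputs (W.output p) γ a, W.matrix b a +
        ∑ k ∈ Finset.range n, ∑ b ∈ W.likelyOutputs (W.output p) γ (c k), W.matrix b a ≤
      ∑ a, p a * ∑ b ∈ W.unlikelyOutputs (W.output p) γ a, W.matrix b a + n * γ⁻¹ := by
  by_contra! h
  set S := W.likelyOutputs (W.output p) γ
  set U := W.unlikelyOutputs (W.output p) γ
  set E := ∑ a, p a * ∑ b ∈ U a, W.matrix b a + n * γ⁻¹ with hE
  have hav : ∑ a, p a * (∑ b ∈ U a, W.matrix b a +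
      ∑ k ∈ Finset.range n, ∑ b ∈ S (c k), W.matrix b a) ≤ E := by
    simp_rw [mul_add, Finset.sum_add_distrib]
    rw [hE]
    gcongr
    simp_rw [Finset.mul_sum]
    rw [Finset.sum_comm]
    -- Averaging W(·|a) over `p` gives the output distribution, under which each likely set has mass
    -- at most 1/γ.
    calc _ ≤ ∑ k ∈ Finset.range n, γ⁻¹ := Finset.sum_le_sum fun k _ => by
            rw [Finset.sum_comm]
            exact W.sum_output_likelyOutputs_le hγ (c k)
      _ = _ := by simp
  obtain ⟨a, ha⟩ : ∃ a, 0 < p a := by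
    by_contra! h0
    have := Finset.sum_nonpos fun a (_ : a ∈ Finset.univ) => h0 a
    rw [hp.2] at this
    linarith
  have hlt : ∑ a, p a * E < ∑ a, p a * (∑ b ∈ U a, W.matrix b a +
      ∑ k ∈ Finset.range n, ∑ b ∈ S (c k), W.matrix b a) :=
    Finset.sum_lt_sum (fun a _ => mul_le_mul_of_nonneg_left (h a).le (hp.1 a))
      ⟨a, Finset.mem_univ a, mul_lt_mul_of_pos_left (h a) ha⟩
  rw [← Finset.sum_mul, hp.2, one_mul] at hlt
  exact hlt.not_ge hav

/-- **Feinstein's lemma.** -/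
lemma exists_code_error_le [Nonempty A] {p : A → ℝ} (hp : p ∈ stdSimplex ℝ A) {γ : ℝ} (hγ : 0 < γ)
    {M : ℕ} (hM : 0 < M) :
    ∃ (g : Fin M → A) (h : B → Fin M), ∀ w, ∑ b with h b ≠ w, W.matrix b (g w) ≤
      ∑ a, p a * ∑ b ∈ W.unlikelyOutputs (W.output p) γ a, W.matrix b a +
        (M - 1) * γ⁻¹ := by
  classical
  set S := W.likelyOutputs (W.output p) γ
  set U := W.unlikelyOutputs (W.output p) γ
  set ε := ∑ a, p a * ∑ b ∈ U a, W.matrix b a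
  have hc : ∀ n : ℕ, ∃ c : ℕ → A, ∀ j < n, ∑ b ∈ U (c j), W.matrix b (c j) +
      ∑ k ∈ Finset.range j, ∑ b ∈ S (c k), W.matrix b (c j) ≤ ε + j * γ⁻¹ := by
    intro n
    induction n with
    | zero =>
      exact ⟨fun _ => Classical.arbitrary A, by simp⟩
    | succ n ih =>
      obtain ⟨c, hc⟩ := ih
      obtain ⟨a, ha⟩ := W.exists_next_codeword hp hγ n c
      refine ⟨Function.update c n a, fun j hj => ?_⟩
      have hlt : ∀ k < n, Function.update c n a k = c k := fun k hk =>
        Function.update_of_ne hk.ne _ _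
      rcases Nat.lt_succ_iff_lt_or_eq.1 hj with h | rfl
      · rw [hlt j h]
        convert hc j h using 2
        exact Finset.sum_congr rfl fun k hk => by
          rw [hlt k ((Finset.mem_range.1 hk).trans h)]
      · rw [Function.update_self]
        convert ha using 2
        exact Finset.sum_congr rfl fun k hk => by rw [hlt k (Finset.mem_range.1 hk)]
  obtain ⟨c, hc⟩ := hc M
  -- The decoder picks the first codeword for which `b` is likely, and message 0 if there is none.
  have hdec : ∀ b, ∃ w : Fin M, (∃ v : Fin M, b ∈ S (c v)) →
      b ∈ S (c w) ∧ ∀ v < w, b ∉ S (c v) := by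
    intro b
    by_cases hb : ∃ v : Fin M, b ∈ S (c v)
    · obtain ⟨w, hw, hmin⟩ := WellFounded.has_min (wellFounded_lt (α := Fin M))
        {v | b ∈ S (c v)} hb
      exact ⟨w, fun _ => ⟨hw, fun v hv hvS => hmin v hvS hv⟩⟩
    · exact ⟨⟨0, hM⟩, fun h => absurd h hb⟩
  choose h hh using hdec
  refine ⟨fun w => c w, h, fun w => ?_⟩
  -- An error for `w` means that `b` is unlikely for `c w` or likely for an earlier codeword; later
  -- codewords do no harm.
  have hsub : ({b | h b ≠ w} : Finset B) ⊆
      U (c w) ∪ (Finset.range w).biUnion fun k => S (c k) := by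
    intro b hb
    rw [Finset.mem_union, W.mem_unlikelyOutputs, Finset.mem_biUnion]
    by_contra! hcon
    obtain ⟨h1, h2⟩ := hcon
    rw [← W.mem_likelyOutputs] at h1
    obtain ⟨h3, h4⟩ := hh b ⟨w, h1⟩
    rcases lt_trichotomy (h b) w with hl | hl | hl
    · exact h2 (h b) (Finset.mem_range.2 hl) h3
    · exact (Finset.mem_filter.1 hb).2 hl
    · exact h4 w hl h1
  have hnn : ∀ b, 0 ≤ W.matrix b (c w) := fun b => W.nonneg b _
  calc ∑ b with h b ≠ w, W.matrix b (c w)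
      ≤ ∑ b ∈ U (c w) ∪ (Finset.range w).biUnion fun k => S (c k), W.matrix b (c w) :=
        Finset.sum_le_sum_of_subset_of_nonneg hsub fun b _ _ => hnn b
    _ ≤ ∑ b ∈ U (c w), W.matrix b (c w) +
          ∑ b ∈ (Finset.range w).biUnion fun k => S (c k), W.matrix b (c w) := by
        rw [← Finset.sum_union_inter]
        exact le_add_of_nonneg_right (Finset.sum_nonneg fun b _ => hnn b)
    _ ≤ ∑ b ∈ U (c w), W.matrix b (c w) +
          ∑ k ∈ Finset.range w, ∑ b ∈ S (c k), W.matrix b (c w) := by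
        gcongr
        exact sum_biUnion_le_of_nonneg _ _ hnn
    _ ≤ ε + (w : ℕ) * γ⁻¹ := hc w w.2
    _ ≤ ε + (M - 1) * γ⁻¹ := by
        have : ((w : ℕ) : ℝ) + 1 ≤ M := by exact_mod_cast w.2
        gcongr
        linarith

end OneShot

/-! ### Chernoff bound and codes for the memoryless channel -/

section Memoryless

variable {X Y : Type*} [Fintype Y] (T : Channel X Y)

lemma errorProb_nonneg {M m : ℕ} (c : BlockCode X Y M m) : 0 ≤ T.errorProb c :=
  div_nonneg (Finset.sum_nonneg fun _ _ => Finset.sum_nonneg fun _ _ =>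
    (T.memoryless m).nonneg _ _) (Nat.cast_nonneg M)

variable [Fintype X]

lemma prod_mem_stdSimplex {p : X → ℝ} (hp : p ∈ stdSimplex ℝ X) (m : ℕ) :
    (fun xs : Fin m → X => ∏ i, p (xs i)) ∈ stdSimplex ℝ (Fin m → X) := by
  refine ⟨fun xs => Finset.prod_nonneg fun i _ => hp.1 _, ?_⟩
  rw [← Fintype.prod_sum fun (_ : Fin m) x => p x]
  simp [hp.2]

lemma output_memoryless (p : X → ℝ) (m : ℕ) (ys : Fin m → Y) :
    (T.memoryless m).output (fun xs => ∏ i, p (xs i)) ys = ∏ i, T.output p (ys i) := by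
  simp only [output, memoryless, ← Finset.prod_mul_distrib]
  rw [← Fintype.prod_sum fun i x => p x * T.matrix (ys i) x]

lemma sum_sum_prod_eq_pow (h : X → Y → ℝ) (m : ℕ) :
    ∑ xs : Fin m → X, ∑ ys : Fin m → Y, ∏ i, h (xs i) (ys i) = (∑ x, ∑ y, h x y) ^ m := by
  simp_rw [← fun xs : Fin m → X => Fintype.prod_sum fun i y => h (xs i) y]
  rw [← Fintype.prod_sum fun (_ : Fin m) x => ∑ y, h x y]
  simp

/-- Since exp t ≤ 1 + t + t² for |t| ≤ 1 and `g` is centred, only the quadratic term survives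
averaging. -/
lemma sum_sum_mul_exp_le {p : X → ℝ} (hp : p ∈ stdSimplex ℝ X) {g : X → Y → ℝ} {B s : ℝ}
    (hg : ∑ x, ∑ y, p x * T.matrix y x * g x y = 0) (hB : ∀ x y, |g x y| ≤ B) (hs : 0 ≤ s)
    (hsB : s * B ≤ 1) :
    ∑ x, ∑ y, p x * T.matrix y x * Real.exp (-s * g x y) ≤ Real.exp (s ^ 2 * B ^ 2) := by
  have hone : ∑ x, ∑ y, p x * T.matrix y x = 1 := by
    simp_rw [← Finset.mul_sum, T.sum_col, mul_one, hp.2]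
  have hpt : ∀ x y, p x * T.matrix y x * Real.exp (-s * g x y) ≤
      p x * T.matrix y x * (1 + s ^ 2 * B ^ 2) - s * (p x * T.matrix y x * g x y) := by
    intro x y
    have h1 : |-s * g x y| ≤ s * B := by
      rw [abs_mul, abs_neg, abs_of_nonneg hs]
      exact mul_le_mul_of_nonneg_left (hB x y) hs
    have h2 := (abs_le.1 (Real.abs_exp_sub_one_sub_id_le (h1.trans hsB))).2
    have h3 : (-s * g x y) ^ 2 ≤ s ^ 2 * B ^ 2 := by
      rw [← mul_pow, ← sq_abs]
      exact pow_le_pow_left₀ (abs_nonneg _) h1 2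
    have h4 : 0 ≤ p x * T.matrix y x := mul_nonneg (hp.1 x) (T.nonneg y x)
    calc _ ≤ p x * T.matrix y x * (1 + s ^ 2 * B ^ 2 - s * g x y) := by
          gcongr
          linarith
      _ = _ := by ring
  calc _ ≤ ∑ x, ∑ y, (p x * T.matrix y x * (1 + s ^ 2 * B ^ 2) -
          s * (p x * T.matrix y x * g x y)) :=
        Finset.sum_le_sum fun x _ => Finset.sum_le_sum fun y _ => hpt x y
    _ = s ^ 2 * B ^ 2 + 1 := by
        simp_rw [Finset.sum_sub_distrib, ← Finset.sum_mul, ← Finset.mul_sum, hg] at *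
        rw [hone]
        ring
    _ ≤ _ := Real.add_one_le_exp _

/-- Chernoff bound: with g the centred log-likelihood ratio, an unlikely output has ∑ (g + δ) ≤ 0
wherever the joint probability is positive. Inserting the weight exp(-s ∑ (g + δ)) ≥ 1 therefore
only increases the sum, which then factors over letters. -/
lemma sum_unlikelyOutputs_memoryless_le {m : ℕ} {p : X → ℝ}
    (hp : p ∈ stdSimplex ℝ X) {J B s : ℝ}
    (hJ : ∑ x, p x * T.divergence (T.output p) x = J)
    (hB : ∀ x y, |Real.log (T.matrix y x / T.output p y) - J| ≤ B) (hs : 0 ≤ s)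
    (hsB : s * B ≤ 1) (δ : ℝ) :
    ∑ xs : Fin m → X, (∏ i, p (xs i)) *
      ∑ ys ∈ (T.memoryless m).unlikelyOutputs ((T.memoryless m).output fun xs => ∏ i, p (xs i))
        (Real.exp (m * (J - δ))) xs, (T.memoryless m).matrix ys xs ≤
      Real.exp (m * (s ^ 2 * B ^ 2 - s * δ)) := by
  set g : X → Y → ℝ := fun x y => Real.log (T.matrix y x / T.output p y) - J with hgdef
  have hg : ∑ x, ∑ y, p x * T.matrix y x * g x y = 0 := by
    have hone : ∑ x, ∑ y, p x * T.matrix y x * J = J := by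
      simp_rw [← Finset.sum_mul, ← Finset.mul_sum, T.sum_col, mul_one, hp.2, one_mul]
    simp_rw [hgdef, mul_sub, Finset.sum_sub_distrib, hone, mul_assoc, ← Finset.mul_sum]
    rw [← hJ]
    exact sub_self _
  set h : X → Y → ℝ := fun x y => p x * T.matrix y x * Real.exp (-s * (g x y + δ)) with hh
  have hpT : ∀ x y, 0 ≤ p x * T.matrix y x := fun x y => mul_nonneg (hp.1 x) (T.nonneg y x)
  have hh0 : ∀ x y, 0 ≤ h x y := fun x y => mul_nonneg (hpT x y) (Real.exp_pos _).le
  calc _ ≤ ∑ xs : Fin m → X, ∑ ys : Fin m → Y, ∏ i, h (xs i) (ys i) := by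
        refine Finset.sum_le_sum fun xs _ => ?_
        rw [Finset.mul_sum]
        refine (Finset.sum_le_sum fun ys hys => ?_).trans
          (Finset.sum_le_univ_sum_of_nonneg fun ys => Finset.prod_nonneg fun i _ => hh0 _ _)
        change (∏ i, p (xs i)) * ∏ i, T.matrix (ys i) (xs i) ≤ _
        rw [← Finset.prod_mul_distrib]
        by_cases hz : ∃ i, p (xs i) * T.matrix (ys i) (xs i) = 0
        · obtain ⟨i, hi⟩ := hz
          rw [Finset.prod_eq_zero (Finset.mem_univ i) hi]
          exact Finset.prod_nonneg fun i _ => hh0 _ _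
        push Not at hz
        have hp0 : ∀ i, 0 < p (xs i) := fun i =>
          (hp.1 _).lt_of_ne (left_ne_zero_of_mul (hz i)).symm
        have hT0 : ∀ i, 0 < T.matrix (ys i) (xs i) := fun i =>
          (T.nonneg _ _).lt_of_ne (right_ne_zero_of_mul (hz i)).symm
        have hq0 : ∀ i, 0 < T.output p (ys i) := fun i => T.output_pos hp.1 (hp0 i) (hT0 i)
        have hle : ∏ i, T.matrix (ys i) (xs i) ≤
            Real.exp (m * (J - δ)) * ∏ i, T.output p (ys i) := by
          rw [← output_memoryless]
          exact (T.memoryless m).mem_unlikelyOutputs.1 hys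
        have hlog : ∑ i, Real.log (T.matrix (ys i) (xs i) / T.output p (ys i)) ≤
            m * (J - δ) := by
          rw [← Real.log_prod fun i _ => (div_pos (hT0 i) (hq0 i)).ne',
            Real.log_le_iff_le_exp (Finset.prod_pos fun i _ => div_pos (hT0 i) (hq0 i)),
            Finset.prod_div_distrib, div_le_iff₀ (Finset.prod_pos fun i _ => hq0 i)]
          exact hle
        have hsum : ∑ i, (g (xs i) (ys i) + δ) ≤ 0 := by
          simp only [hgdef, Finset.sum_add_distrib, Finset.sum_sub_distrib, Finset.sum_const,
            Finset.card_univ, Fintype.card_fin, nsmul_eq_mul]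
          linarith
        rw [show ∏ i, h (xs i) (ys i) = _ from Finset.prod_mul_distrib, ← Real.exp_sum,
          ← Finset.mul_sum]
        refine le_mul_of_one_le_right (Finset.prod_nonneg fun i _ => hpT _ _) ?_
        exact Real.one_le_exp (mul_nonneg_of_nonpos_of_nonpos (neg_nonpos.2 hs) hsum)
    _ = (∑ x, ∑ y, h x y) ^ m := sum_sum_prod_eq_pow h m
    _ ≤ Real.exp (s ^ 2 * B ^ 2 - s * δ) ^ m := by
        refine pow_le_pow_left₀
          (Finset.sum_nonneg fun x _ => Finset.sum_nonneg fun y _ => hh0 x y) ?_ m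
        have : ∀ x y, h x y =
            p x * T.matrix y x * Real.exp (-s * g x y) * Real.exp (-(s * δ)) := fun x y => by
          rw [hh, mul_assoc, ← Real.exp_add]
          ring_nf
        simp_rw [this, ← Finset.sum_mul]
        rw [sub_eq_add_neg, Real.exp_add]
        gcongr
        exact T.sum_sum_mul_exp_le hp hg hB hs hsB
    _ = _ := by rw [← Real.exp_nat_mul]

lemma exists_blockCode_errorProb_le [Nonempty X] {p : X → ℝ}
    (hp : p ∈ stdSimplex ℝ X) {J B s : ℝ}
    (hJ : ∑ x, p x * T.divergence (T.output p) x = J)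
    (hB : ∀ x y, |Real.log (T.matrix y x / T.output p y) - J| ≤ B) (hs : 0 ≤ s)
    (hsB : s * B ≤ 1) (δ : ℝ) {M : ℕ} (hM : 0 < M) (m : ℕ) :
    ∃ c : BlockCode X Y M m, T.errorProb c ≤
      Real.exp (m * (s ^ 2 * B ^ 2 - s * δ)) + (M - 1) * Real.exp (-(m * (J - δ))) := by
  classical
  obtain ⟨g, h, hgh⟩ := (T.memoryless m).exists_code_error_le (prod_mem_stdSimplex hp m)
    (Real.exp_pos (m * (J - δ))) hM
  refine ⟨⟨g, h⟩, ?_⟩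
  rw [errorProb, div_le_iff₀' (Nat.cast_pos.2 hM)]
  calc _ ≤ ∑ w : Fin M, (Real.exp (m * (s ^ 2 * B ^ 2 - s * δ)) +
          (M - 1) * Real.exp (-(m * (J - δ)))) := Finset.sum_le_sum fun w _ => by
        refine (Eq.trans_le ?_ (hgh w)).trans ?_
        · rfl
        · rw [← Real.exp_neg]
          exact add_le_add_left
            (T.sum_unlikelyOutputs_memoryless_le hp hJ hB hs hsB δ) _
    _ = _ := by simp [mul_add]

/-- Reliable transmission is possible at rates that stay below the capacity by a margin vanishing
slowly enough. -/
lemma isReliable_of_eventually_le [Nonempty X] (R : ℕ → ℝ)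
    (hR : ∀ᶠ m : ℕ in atTop,
      R m * Real.log 2 ≤ T.capacity * Real.log 2 - 2 * (m : ℝ) ^ (-(1 / 4) : ℝ)) :
    T.IsReliable fun m => ⌈(2 : ℝ) ^ ((m : ℝ) * R m)⌉₊ := by
  obtain ⟨p, hp, hpC⟩ := T.isGreatest_capacity.1
  set J := T.capacity * Real.log 2 with hJdef
  have hJ : ∑ x, p x * T.divergence (T.output p) x = J := by
    rw [← inputOutputInfo_mul_log_two, hpC]
  obtain ⟨B, hB⟩ : ∃ B, ∀ x y, |Real.log (T.matrix y x / T.output p y) - J| ≤ B := by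
    obtain ⟨B, hB⟩ := Finite.bddAbove_range
      fun z : X × Y => |Real.log (T.matrix z.2 z.1 / T.output p z.2) - J|
    exact ⟨B, fun x y => hB ⟨(x, y), rfl⟩⟩
  have hM : ∀ m : ℕ, 0 < ⌈(2 : ℝ) ^ ((m : ℝ) * R m)⌉₊ := fun m =>
    Nat.ceil_pos.2 (Real.rpow_pos_of_pos two_pos _)
  -- The choice s = m^(-1/2), δ = m^(-1/4) keeps m s² B² equal to B² while m s δ = m^(1/4) diverges.
  -- An arbitrary code serves while s B > 1.
  have hcode : ∀ m : ℕ, ∃ c : BlockCode X Y ⌈(2 : ℝ) ^ ((m : ℝ) * R m)⌉₊ m,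
      (m : ℝ) ^ (-(1 / 2) : ℝ) * B ≤ 1 → T.errorProb c ≤
        Real.exp (m * (((m : ℝ) ^ (-(1 / 2) : ℝ)) ^ 2 * B ^ 2 -
          (m : ℝ) ^ (-(1 / 2) : ℝ) * (m : ℝ) ^ (-(1 / 4) : ℝ))) +
        ((⌈(2 : ℝ) ^ ((m : ℝ) * R m)⌉₊ : ℝ) - 1) *
          Real.exp (-(m * (J - (m : ℝ) ^ (-(1 / 4) : ℝ)))) := by
    intro m
    by_cases h : (m : ℝ) ^ (-(1 / 2) : ℝ) * B ≤ 1
    · obtain ⟨c, hc⟩ := T.exists_blockCode_errorProb_le hp hJ hB (by positivity) h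
        ((m : ℝ) ^ (-(1 / 4) : ℝ)) (hM m) m
      exact ⟨c, fun _ => hc⟩
    · exact ⟨⟨fun _ _ => Classical.arbitrary X, fun _ => ⟨0, hM m⟩⟩, fun h' => absurd h' h⟩
  choose c hc using hcode
  refine ⟨c, ?_⟩
  have hev1 : ∀ᶠ m : ℕ in atTop, (m : ℝ) ^ (-(1 / 2) : ℝ) * B ≤ 1 := by
    have : Tendsto (fun m : ℕ => (m : ℝ) ^ (-(1 / 2) : ℝ) * B) atTop (𝓝 (0 * B)) :=
      ((tendsto_rpow_neg_atTop (by norm_num)).comp tendsto_natCast_atTop_atTop).mul_const B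
    rw [zero_mul] at this
    exact this.eventually (eventually_le_nhds one_pos)
  have hbound : ∀ᶠ m : ℕ in atTop, T.errorProb (c m) ≤
      Real.exp (B ^ 2 - (m : ℝ) ^ (1 / 4 : ℝ)) + Real.exp (-(m : ℝ) ^ (3 / 4 : ℝ)) := by
    filter_upwards [hev1, hR, eventually_gt_atTop 0] with m h1 h2 hm
    have hm' : (0 : ℝ) < m := Nat.cast_pos.2 hm
    refine (hc m h1).trans (add_le_add (Real.exp_le_exp.2 (le_of_eq ?_)) ?_)
    · have e1 : (m : ℝ) * ((m : ℝ) ^ (-(1 / 2) : ℝ)) ^ 2 = 1 := by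
        rw [← Real.rpow_natCast, ← Real.rpow_mul hm'.le]
        norm_num [Real.rpow_neg_one, hm'.ne']
      have e2 : (m : ℝ) * ((m : ℝ) ^ (-(1 / 2) : ℝ) * (m : ℝ) ^ (-(1 / 4) : ℝ)) =
          (m : ℝ) ^ (1 / 4 : ℝ) := by
        rw [← Real.rpow_add hm', ← Real.rpow_one_add' hm'.le] <;> norm_num
      rw [mul_sub, ← mul_assoc, e1, e2, one_mul]
    · have e3 : (m : ℝ) * (m : ℝ) ^ (-(1 / 4) : ℝ) = (m : ℝ) ^ (3 / 4 : ℝ) := by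
        rw [← Real.rpow_one_add' hm'.le] <;> norm_num
      -- The -1 in Feinstein's bound absorbs the rounding up.
      have h3 : (⌈(2 : ℝ) ^ ((m : ℝ) * R m)⌉₊ : ℝ) - 1 ≤
          Real.exp (m * (R m * Real.log 2)) := by
        have := Nat.ceil_lt_add_one (Real.rpow_pos_of_pos two_pos ((m : ℝ) * R m)).le
        rw [Real.rpow_def_of_pos two_pos] at this ⊢
        rw [show m * (R m * Real.log 2) = Real.log 2 * (m * R m) by ring]
        linarith
      refine (mul_le_mul_of_nonneg_right h3 (Real.exp_pos _).le).trans ?_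
      rw [← Real.exp_add, Real.exp_le_exp]
      -- Of the margin 2δ, the threshold uses one δ; the other leaves exp(-m δ) = exp(-m^(3/4)).
      have := mul_le_mul_of_nonneg_left h2 hm'.le
      nlinarith
  have hpow : ∀ a : ℝ, 0 < a → Tendsto (fun m : ℕ => (m : ℝ) ^ a) atTop atTop := fun a ha =>
    (tendsto_rpow_atTop ha).comp tendsto_natCast_atTop_atTop
  have hlim : Tendsto (fun m : ℕ => Real.exp (B ^ 2 - (m : ℝ) ^ (1 / 4 : ℝ)) +
      Real.exp (-(m : ℝ) ^ (3 / 4 : ℝ))) atTop (𝓝 (0 + 0)) := by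
    refine (Real.tendsto_exp_atBot.comp ?_).add (Real.tendsto_exp_atBot.comp ?_)
    · exact tendsto_atBot_add_const_left _ _
        (tendsto_neg_atTop_atBot.comp (hpow _ (by norm_num)))
    · exact tendsto_neg_atTop_atBot.comp (hpow _ (by norm_num))
  rw [add_zero] at hlim
  exact tendsto_of_tendsto_of_tendsto_of_le_of_le' tendsto_const_nhds hlim
    (Eventually.of_forall fun m => T.errorProb_nonneg (c m)) hbound

/-- Below capacity, transmission is reliable. -/
lemma isReliable_of_lt_capacity [Nonempty X] {R : ℝ} (hR : R < T.capacity) :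
    T.IsReliable fun m => ⌈(2 : ℝ) ^ ((m : ℝ) * R)⌉₊ := by
  refine T.isReliable_of_eventually_le (fun _ => R) ?_
  have h : Tendsto (fun m : ℕ => T.capacity * Real.log 2 - 2 * (m : ℝ) ^ (-(1 / 4) : ℝ)) atTop
      (𝓝 (T.capacity * Real.log 2 - 2 * 0)) :=
    (((tendsto_rpow_neg_atTop (by norm_num)).comp
      tendsto_natCast_atTop_atTop).const_mul 2).const_sub _
  rw [mul_zero, sub_zero] at h
  exact h.eventually (eventually_ge_nhds
    (mul_lt_mul_of_pos_right hR (Real.log_pos one_lt_two)))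

/-- Rates `r m` tending to R from below with exactly the permitted margin cover the boundary case R
= C. -/
lemma isAchievable_of_le_capacity [Nonempty X] {R : ℝ} (hR : R ≤ T.capacity) :
    T.IsAchievable R := by
  have hl : 0 < Real.log 2 := Real.log_pos one_lt_two
  set r : ℕ → ℝ := fun m => R - 2 * (m : ℝ) ^ (-(1 / 4) : ℝ) / Real.log 2 with hr
  refine ⟨fun m => ⌈(2 : ℝ) ^ ((m : ℝ) * r m)⌉₊, fun δ hδ => ?_,
    T.isReliable_of_eventually_le r (Eventually.of_forall fun m => ?_)⟩
  · have h : Tendsto r atTop (𝓝 (R - 2 * 0 / Real.log 2)) :=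
      ((((tendsto_rpow_neg_atTop (by norm_num)).comp
        tendsto_natCast_atTop_atTop).const_mul 2).div_const _).const_sub _
    rw [mul_zero, zero_div, sub_zero] at h
    filter_upwards [h.eventually (eventually_ge_nhds (sub_lt_self R hδ)),
      eventually_gt_atTop 0] with m h1 hm
    refine h1.trans ?_
    rw [le_div_iff₀' (Nat.cast_pos.2 hm),
      Real.le_logb_iff_rpow_le one_lt_two
        (Nat.cast_pos.2 (Nat.ceil_pos.2 (Real.rpow_pos_of_pos two_pos _)))]
    exact Nat.le_ceil _
  · rw [hr, sub_mul, div_mul_cancel₀ _ hl.ne']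
    exact sub_le_sub_right (mul_le_mul_of_nonneg_right hR hl.le) _

end Memoryless

/-! ### Converse through divergence from a product distribution -/

section Converse

variable {X Y : Type*} [Fintype Y] (T : Channel X Y)

open Classical in
/-- The distribution of the `i`-th letter of a codeword drawn uniformly at random. -/
noncomputable def letterDist {M m : ℕ} (g : Fin M → Fin m → X) (i : Fin m) (x : X) : ℝ :=
  (∑ w, if g w i = x then 1 else 0) / M

lemma sum_letterDist_mul [Fintype X] {M m : ℕ} (g : Fin M → Fin m → X) (i : Fin m) (f : X → ℝ) :
    ∑ x, letterDist g i x * f x = (∑ w, f (g w i)) / M := by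
  classical
  simp_rw [letterDist, div_mul_eq_mul_div, ← Finset.sum_div, Finset.sum_mul]
  rw [Finset.sum_comm]
  simp

lemma letterDist_mem_stdSimplex [Fintype X] {M m : ℕ} (hM : 0 < M) (g : Fin M → Fin m → X) (i : Fin m) :
    letterDist g i ∈ stdSimplex ℝ X := by
  classical
  refine ⟨fun x => div_nonneg (Finset.sum_nonneg fun w _ => by positivity)
    (Nat.cast_nonneg M), ?_⟩
  have := sum_letterDist_mul g i fun _ => 1
  have hM' : (M : ℝ) ≠ 0 := by positivity
  simpa [hM'] using this

/-- Supplies absolute continuity: every output letter reachable from a codeword has positive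
probability under the single-letter output distribution. -/
lemma letterDist_pos {M m : ℕ} (g : Fin M → Fin m → X) (i : Fin m) (w : Fin M) :
    0 < letterDist g i (g w i) := by
  classical
  refine div_pos ?_ (Nat.cast_pos.2 (Fin.pos w))
  refine one_pos.trans_le ?_
  have := Finset.single_le_sum (f := fun v => if g v i = g w i then (1 : ℝ) else 0)
    (fun v _ => by positivity) (Finset.mem_univ w)
  simpa using this

lemma sum_memoryless_mul_apply {m : ℕ} (xs : Fin m → X) (j : Fin m) (f : Y → ℝ) :
    ∑ ys, (T.memoryless m).matrix ys xs * f (ys j) = ∑ y, T.matrix y (xs j) * f y := by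
  classical
  have h : ∀ ys : Fin m → Y, (T.memoryless m).matrix ys xs * f (ys j) =
      ∏ i, (T.matrix (ys i) (xs i) * if i = j then f (ys i) else 1) := fun ys => by
    rw [Finset.prod_mul_distrib]
    simp [memoryless]
  simp_rw [h]
  rw [← Fintype.prod_sum fun i y => T.matrix y (xs i) * if i = j then f y else 1,
    Finset.prod_eq_single j]
  · simp
  · intro i _ hi
    simp [hi, T.sum_col]
  · simp

lemma pos_of_memoryless_pos {m : ℕ} {xs : Fin m → X} {ys : Fin m → Y}
    (h : 0 < (T.memoryless m).matrix ys xs) (i : Fin m) : 0 < T.matrix (ys i) (xs i) :=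
  (T.nonneg _ _).lt_of_ne' fun h0 => h.ne' (Finset.prod_eq_zero (Finset.mem_univ i) h0)

/-- The divergence from a product distribution is the sum of the divergences of the letters. -/
lemma divergence_memoryless {m : ℕ} (xs : Fin m → X) (q : Fin m → Y → ℝ)
    (hq : ∀ i y, 0 < T.matrix y (xs i) → 0 < q i y) :
    (T.memoryless m).divergence (fun ys => ∏ i, q i (ys i)) xs =
      ∑ i, T.divergence (q i) (xs i) := by
  have h : ∀ ys, (T.memoryless m).matrix ys xs *
      Real.log ((T.memoryless m).matrix ys xs / ∏ i, q i (ys i)) =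
      ∑ i, (T.memoryless m).matrix ys xs * Real.log (T.matrix (ys i) (xs i) / q i (ys i)) := by
    intro ys
    rcases eq_or_ne ((T.memoryless m).matrix ys xs) 0 with h0 | h0
    · simp [h0]
    have hT : ∀ i, 0 < T.matrix (ys i) (xs i) :=
      T.pos_of_memoryless_pos (((T.memoryless m).nonneg _ _).lt_of_ne' h0)
    rw [← Finset.mul_sum, ← Real.log_prod fun i _ => (div_pos (hT i) (hq i _ (hT i))).ne',
      Finset.prod_div_distrib]
    rfl
  rw [divergence]
  simp_rw [h]
  rw [Finset.sum_comm]
  exact Finset.sum_congr rfl fun i _ =>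
    T.sum_memoryless_mul_apply xs i fun y => Real.log (T.matrix y (xs i) / q i y)

/-- The variational lower bound on a single term of a divergence. -/
lemma mul_add_sub_le_mul_log_div {a b : ℝ} (ha : 0 ≤ a) (hb : 0 ≤ b) (hab : 0 < a → 0 < b)
    (φ : ℝ) : a * φ + a - b * Real.exp φ ≤ a * Real.log (a / b) := by
  rcases ha.eq_or_lt with rfl | ha
  · have := mul_nonneg hb (Real.exp_pos φ).le
    simpa using this
  have hb := hab ha
  -- The tangent inequality 1 + t ≤ exp t at t = φ - log(a/b), multiplied by `a`.
  have h := Real.add_one_le_exp (φ - Real.log (a / b))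
  rw [Real.exp_sub, Real.exp_log (div_pos ha hb)] at h
  have := mul_le_mul_of_nonneg_left h ha.le
  have e : a * (Real.exp φ / (a / b)) = b * Real.exp φ := by field_simp
  rw [e] at this
  linarith

lemma sum_messageError {M m : ℕ} (c : BlockCode X Y M m) (w : Fin M) :
    ∑ ys, (T.memoryless m).matrix ys (c.encode w) * (if c.decode ys = w then 1 else 0) =
      1 - T.messageError c w := by
  rw [messageError, eq_sub_iff_add_eq, Finset.sum_filter, ← Finset.sum_add_distrib]
  refine Eq.trans ?_ ((T.memoryless m).sum_col (c.encode w))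
  refine Finset.sum_congr rfl fun ys _ => ?_
  by_cases h : c.decode ys = w <;> simp [h]

/-- A bound of Fano type on the size of a code. -/
lemma one_sub_errorProb_mul_log_le [Fintype X] [Nonempty X] {M m : ℕ} (hM : 0 < M)
    (c : BlockCode X Y M m) :
    (1 - T.errorProb c) * Real.log M ≤ m * (T.capacity * Real.log 2) + 1 := by
  have hM' : (0 : ℝ) < M := Nat.cast_pos.2 hM
  set p : Fin m → X → ℝ := fun i => letterDist c.encode i
  have hp : ∀ i, p i ∈ stdSimplex ℝ X := fun i => letterDist_mem_stdSimplex hM c.encode i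
  -- `Q` need not be the true output distribution; being a product, it makes the divergences
  -- additive over letters.
  set Q : (Fin m → Y) → ℝ := fun ys => ∏ i, T.output (p i) (ys i)
  have hQ0 : ∀ ys, 0 ≤ Q ys := fun ys =>
    Finset.prod_nonneg fun i _ => T.output_nonneg (hp i).1 _
  have hQ1 : ∑ ys, Q ys = 1 := by
    rw [← Fintype.prod_sum fun i y => T.output (p i) y]
    exact Finset.prod_eq_one fun i _ => T.sum_output (hp i).2
  have hq : ∀ w i y, 0 < T.matrix y (c.encode w i) → 0 < T.output (p i) y := fun w i y h =>
    T.output_pos (hp i).1 (letterDist_pos c.encode i w) h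
  have hupper : ∑ w, (T.memoryless m).divergence Q (c.encode w) ≤
      M * (m * (T.capacity * Real.log 2)) := by
    calc _ = ∑ w, ∑ i, T.divergence (T.output (p i)) (c.encode w i) :=
          Finset.sum_congr rfl fun w _ =>
            T.divergence_memoryless (c.encode w) (fun i => T.output (p i)) (hq w)
      _ = ∑ i, M * ∑ x, p i x * T.divergence (T.output (p i)) x := by
          rw [Finset.sum_comm]
          refine Finset.sum_congr rfl fun i _ => ?_
          rw [sum_letterDist_mul, mul_div_cancel₀ _ hM'.ne']
      _ ≤ ∑ i : Fin m, M * (T.capacity * Real.log 2) := by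
          gcongr with i
          exact T.sum_mul_divergence_le_capacity (hp i)
      _ = _ := by simp; ring
  have hexp : ∀ w ys, Real.exp ((if c.decode ys = w then 1 else 0) * Real.log M) ≤
      1 + M * if c.decode ys = w then 1 else 0 := by
    intro w ys
    split_ifs
    · rw [one_mul, Real.exp_log hM']
      linarith
    · simp
  have hlower : ∑ w, ((1 - T.messageError c w) * Real.log M + 1 -
      ∑ ys, Q ys * (1 + M * if c.decode ys = w then 1 else 0)) ≤
      ∑ w, (T.memoryless m).divergence Q (c.encode w) := by
    refine Finset.sum_le_sum fun w _ => ?_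
    have hsum : (1 - T.messageError c w) * Real.log M + 1 =
        ∑ ys, ((T.memoryless m).matrix ys (c.encode w) *
          ((if c.decode ys = w then 1 else 0) * Real.log M) +
            (T.memoryless m).matrix ys (c.encode w)) := by
      rw [← sum_messageError, Finset.sum_add_distrib, (T.memoryless m).sum_col, Finset.sum_mul]
      simp_rw [mul_assoc]
    rw [hsum, ← Finset.sum_sub_distrib, divergence]
    refine Finset.sum_le_sum fun ys _ => le_trans ?_ (mul_add_sub_le_mul_log_div
      ((T.memoryless m).nonneg _ _) (hQ0 ys) (fun h => Finset.prod_pos fun i _ => hq w i _ ?_)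
      ((if c.decode ys = w then 1 else 0) * Real.log M))
    · exact sub_le_sub_left (mul_le_mul_of_nonneg_left (hexp w ys) (hQ0 ys)) _
    · exact T.pos_of_memoryless_pos h i
  -- Each output is decoded to exactly one message, so the total is M + M for any decoder.
  have hQM : ∑ w, ∑ ys, Q ys * (1 + M * if c.decode ys = w then 1 else 0) = 2 * M := by
    rw [Finset.sum_comm]
    simp_rw [← Finset.mul_sum, Finset.sum_add_distrib, ← Finset.mul_sum]
    simp only [Finset.sum_ite_eq, Finset.mem_univ, if_true, Finset.sum_const, Finset.card_univ,
      Fintype.card_fin, nsmul_eq_mul, mul_one, ← Finset.sum_mul, hQ1]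
    ring
  have herr : ∑ w, (1 - T.messageError c w) = M * (1 - T.errorProb c) := by
    rw [errorProb, mul_sub, mul_div_cancel₀ _ hM'.ne']
    simp
  rw [Finset.sum_sub_distrib, hQM, Finset.sum_add_distrib, ← Finset.sum_mul, herr] at hlower
  simp only [Finset.sum_const, Finset.card_univ, Fintype.card_fin, nsmul_eq_mul,
    mul_one] at hlower
  refine le_of_mul_le_mul_left ?_ hM'
  linarith

lemma nonempty_output (T : Channel X Y) [Nonempty X] : Nonempty Y := by
  by_contra h
  rw [not_nonempty_iff] at h
  simpa using T.sum_col (Classical.arbitrary X)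

/-- The decoder must return a message on some output word. -/
lemma blockCode_pos (T : Channel X Y) [Nonempty X] {M m : ℕ} (c : BlockCode X Y M m) : 0 < M :=
  have := T.nonempty_output
  Fin.pos (c.decode fun _ => Classical.arbitrary Y)

lemma le_capacity_of_isAchievable [Fintype X] [Nonempty X] {R : ℝ} (hR : T.IsAchievable R) :
    R ≤ T.capacity := by
  obtain ⟨M, hM, c, hc⟩ := hR
  have hl : 0 < Real.log 2 := Real.log_pos one_lt_two
  refine le_of_forall_pos_le_add fun δ hδ => ?_
  rw [← sub_le_iff_le_add]
  have hinv : Tendsto (fun m : ℕ => ((m : ℝ) * Real.log 2)⁻¹) atTop (𝓝 0) :=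
    (tendsto_natCast_atTop_atTop.atTop_mul_const hl).inv_tendsto_atTop
  have h1 : Tendsto (fun m => (1 - T.errorProb (c m)) * (R - δ)) atTop
      (𝓝 ((1 - 0) * (R - δ))) := (hc.const_sub 1).mul_const _
  have h2 : Tendsto (fun m : ℕ => T.capacity + ((m : ℝ) * Real.log 2)⁻¹) atTop
      (𝓝 (T.capacity + 0)) := hinv.const_add _
  rw [sub_zero, one_mul] at h1
  rw [add_zero] at h2
  refine le_of_tendsto_of_tendsto h1 h2 ?_
  filter_upwards [hM δ hδ, eventually_gt_atTop 0,
    hc.eventually (eventually_le_nhds one_pos)] with m hm hm0 hm1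
  have hm0' : (0 : ℝ) < m := Nat.cast_pos.2 hm0
  refine (mul_le_mul_of_nonneg_left hm (sub_nonneg.2 hm1)).trans ?_
  have := T.one_sub_errorProb_mul_log_le (T.blockCode_pos (c m)) (c m)
  rw [Real.logb, div_div, ← mul_div_assoc, div_le_iff₀ (by positivity), add_mul,
    mul_comm (Real.log 2), inv_mul_cancel₀ (by positivity)]
  linarith

lemma le_capacity_of_isReliable_floor [Fintype X] [Nonempty X] {R : ℝ}
    (hR : T.IsReliable fun m => ⌊(2 : ℝ) ^ ((m : ℝ) * R)⌋₊) : R ≤ T.capacity := by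
  -- If R < 0, the message set at block length 1 would be empty, and no code exists.
  have hR0 : 0 ≤ R := by
    obtain ⟨c, -⟩ := hR
    have h := Nat.floor_pos.1 (T.blockCode_pos (c 1))
    rw [Nat.cast_one, one_mul] at h
    by_contra! hneg
    exact h.not_gt (Real.rpow_lt_one_of_one_lt_of_neg one_lt_two hneg)
  refine T.le_capacity_of_isAchievable ⟨_, fun δ hδ => ?_, hR⟩
  have hinv : Tendsto (fun m : ℕ => (m : ℝ)⁻¹) atTop (𝓝 0) :=
    tendsto_natCast_atTop_atTop.inv_tendsto_atTop
  filter_upwards [hinv.eventually (eventually_le_nhds hδ), eventually_gt_atTop 0] with m h1 hm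
  have hm' : (0 : ℝ) < m := Nat.cast_pos.2 hm
  have hone : (1 : ℝ) ≤ 2 ^ ((m : ℝ) * R) :=
    Real.one_le_rpow one_le_two (mul_nonneg hm'.le hR0)
  have hpos : (1 : ℝ) ≤ ⌊(2 : ℝ) ^ ((m : ℝ) * R)⌋₊ := by
    exact_mod_cast Nat.floor_pos.2 hone
  -- For x ≥ 1, ⌊x⌋ ≥ x/2: rounding down costs at most one bit, hence at most 1/m in rate.
  have hlog : (m : ℝ) * R - 1 ≤ Real.logb 2 ⌊(2 : ℝ) ^ ((m : ℝ) * R)⌋₊ := by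
    rw [Real.le_logb_iff_rpow_le one_lt_two (one_pos.trans_le hpos),
      Real.rpow_sub two_pos, Real.rpow_one]
    have := Nat.lt_floor_add_one ((2 : ℝ) ^ ((m : ℝ) * R))
    linarith
  rw [le_div_iff₀ hm']
  have : 1 ≤ δ * m := by rwa [inv_le_iff_one_le_mul₀ hm'] at h1
  linarith

end Converse

end Channel

theorem mainTheorem4 {X Y : Type*} [Fintype X] [Nonempty X] [Fintype Y] (T : Channel X Y) :
    -- the capacity is a maximum
    IsGreatest (T.inputOutputInfo '' stdSimplex ℝ X) T.capacity ∧
    -- the achievable rates are exactly those that do not exceed the capacity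
    (∀ R : ℝ, T.IsAchievable R ↔ R ≤ T.capacity) ∧
    -- below capacity, message sets of size `2 ^ (m * R)` can be used
    (∀ R : ℝ, R < T.capacity → T.IsReliable fun m => ⌈(2 : ℝ) ^ ((m : ℝ) * R)⌉₊) ∧
    -- message sets of size `2 ^ (m * R)` can only be used up to capacity
    (∀ R : ℝ, (T.IsReliable fun m => ⌊(2 : ℝ) ^ ((m : ℝ) * R)⌋₊) → R ≤ T.capacity) :=
  ⟨T.isGreatest_capacity, fun _ => ⟨T.le_capacity_of_isAchievable, T.isAchievable_of_le_capacity⟩,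
    fun _ => T.isReliable_of_lt_capacity, fun _ => T.le_capacity_of_isReliable_floor⟩
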